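/- Let $I\subseteq\mathbb R$ be an open interval and let $A_1,A_2,A_3:I\to\mathbb R$ be smooth and nowhere zero, no two of them proportional. Consider the (proper, diagonal) Bianchi I space-time $I\times\mathbb R^3$ with metric $$ds^2=-dt^2+\sum_{\mu=1}^{3}A_\mu(t)^2(dx^\mu)^2 ,\qquad x^0=t,$$ and Ricci tensor $R_{ab}$. Assume it is a perfect-fluid space-time: its Einstein tensor is $G_{ab}=(\rho+p)u_au_b+p\,g_{ab}$ with $g_{ab}u^au^b=-1$, for some density $\rho$, pressure $p$ and four-velocity $u^a$ (units with $8\pi G=c=1$, zero cosmological constant). A smooth vector field $X$ is a Ricci collineation if $\mathcal L_XR_{ab}=0$; it is called proper if it is not of a more special type (Killing, homothetic, affine, curvature collineation, etc.). (i) Suppose $R_{00}$ vanishes nowhere, and that there are constants $c_\mu$ and $C_\mu\neq0$ ($\mu=1,2,3$) such that for some primitive $\int\sqrt{|R_{00}|}\,dt$ on $I$ $$\frac{C_1}{C_2}e^{2(c_1-c_2)\int\sqrt{|R_{00}|}dt}=\frac{A_1^2}{A_2^2},\qquad \frac{C_1}{C_3}e^{2(c_1-c_3)\int\sqrt{|R_{00}|}dt}=\frac{A_1^2}{A_3^2}.$$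 This condition depends on the $c_\mu$ only through their differences. Normalize them by replacing $c_\mu$ with $c_\mu-\tfrac13(c_1+c_2+c_3)$, so that $c_1+c_2+c_3=0$. Then $$X=\frac{1}{\sqrt{|R_{00}|}}\,\partial_0-\sum_{\mu=1}^{3}c_\mu x^\mu\partial_\mu$$ is a Ricci collineation. If the constants are chosen such that $R_{\mu\mu}=C_\mu e^{2c_\mu\int\sqrt{|R_{00}|}dt}$ (no summation) for each $\mu$, then $X$ is a Ricci collineation with the $c_\mu$ as they stand. (ii) Suppose the fluid has a linear barotropic equation of state $p=(\gamma-1)\rho$ with $\gamma$ constant, and that the Ricci tensor is non-degenerate at every point, $\det R_{ab}\neq0$ (so in particular $\gamma\neq2$). Then the space-time admits no proper Ricci collineation. More precisely, every smooth Ricci collineation on an open subset of the space-time is a Killing vector field there. -/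

import Mathlib

open scoped ContDiff

noncomputable section

namespace BianchiI

/-- Coordinate space of events `x = (t, x¹, x², x³)`; the index `0` is the time coordinate `t`. -/
abbrev Event : Type := Fin 4 → ℝ

/-- A field of covariant 2-tensors on coordinate space, given by its components. -/
abbrev TensorField : Type := Event → Matrix (Fin 4) (Fin 4) ℝ

/-- A vector field on coordinate space, given by its (contravariant) components. -/
abbrev VField : Type := Event → Event

/-- The partial derivative `∂_a f` at `x`. -/
def pd (a : Fin 4) (f : Event → ℝ) (x : Event) : ℝ :=
  fderiv ℝ f x (Pi.single a 1)

/-- Christoffel symbols `Γ^a_{bc} = ½ g^{ad} (∂_b g_{dc} + ∂_c g_{db} - ∂_d g_{bc})`. -/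
def christoffel (g : TensorField) (a b c : Fin 4) (x : Event) : ℝ :=
  (1 / 2) * ∑ d, (g x)⁻¹ a d *
    (pd b (fun y => g y d c) x + pd c (fun y => g y d b) x - pd d (fun y => g y b c) x)

/-- Ricci tensor
`R_{bc} = ∂_a Γ^a_{bc} - ∂_c Γ^a_{ba} + Γ^a_{ad} Γ^d_{bc} - Γ^a_{cd} Γ^d_{ba}`. -/
def ricci (g : TensorField) : TensorField := fun x => Matrix.of fun b c =>
  (∑ a, pd a (christoffel g a b c) x) - (∑ a, pd c (christoffel g a b a) x)
    + ∑ a, ∑ d, (christoffel g a a d x * christoffel g d b c x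
        - christoffel g a c d x * christoffel g d b a x)

/-- Scalar curvature `R = g^{ab} R_{ab}`. -/
def scalarCurvature (g : TensorField) (x : Event) : ℝ :=
  ∑ a, ∑ b, (g x)⁻¹ a b * ricci g x a b

/-- Einstein tensor `G_{ab} = R_{ab} - ½ R g_{ab}`. -/
def einstein (g : TensorField) : TensorField := fun x =>
  ricci g x - (scalarCurvature g x / 2) • g x

/-- Lie derivative `(L_X T)_{ab} = X^c ∂_c T_{ab} + T_{cb} ∂_a X^c + T_{ac} ∂_b X^c`. -/
def lieDeriv (X : VField) (T : TensorField) (a b : Fin 4) (x : Event) : ℝ :=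
  ∑ c, (X x c * pd c (fun y => T y a b) x
    + T x c b * pd a (fun y => X y c) x
    + T x a c * pd b (fun y => X y c) x)

/-- `X` is a smooth Ricci collineation of `g` on the open set `U`: `L_X R_{ab} = 0`. -/
structure IsRicciCollineation (g : TensorField) (U : Set Event) (X : VField) : Prop where
  smooth : ContDiffOn ℝ ∞ X U
  lie_eq_zero : ∀ x ∈ U, ∀ a b, lieDeriv X (ricci g) a b x = 0

/-- `X` is a smooth Killing vector field of `g` on the open set `U`: `L_X g_{ab} = 0`. -/
structure IsKilling (g : TensorField) (U : Set Event) (X : VField) : Prop where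
  smooth : ContDiffOn ℝ ∞ X U
  lie_eq_zero : ∀ x ∈ U, ∀ a b, lieDeriv X g a b x = 0

/-- The Bianchi I metric `ds² = -dt² + ∑_μ A_μ(t)² (dx^μ)²` in synchronous coordinates. -/
def metric (A : Fin 3 → ℝ → ℝ) : TensorField := fun x =>
  Matrix.diagonal (Fin.cons (-1) fun μ : Fin 3 => A μ (x 0) ^ 2)

/-- The space-time manifold `I × ℝ³`. -/
def domain (I : Set ℝ) : Set Event := {x | x 0 ∈ I}

/-- The metric functions `A_μ` define a *proper* diagonal Bianchi I space-time on `I × ℝ³`: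
they are smooth and nowhere zero on the open interval `I`, and no two of them are proportional.
(If two are proportional, rescaling a spatial coordinate makes them equal and the
space-time is plane symmetric.) -/
structure IsProperBianchiI (A : Fin 3 → ℝ → ℝ) (I : Set ℝ) : Prop where
  isOpen : IsOpen I
  ordConnected : I.OrdConnected
  smooth : ∀ μ, ContDiffOn ℝ ∞ (A μ) I
  ne_zero : ∀ μ, ∀ t ∈ I, A μ t ≠ 0
  not_proportional : ∀ μ ν, μ ≠ ν → ¬ ∃ k : ℝ, ∀ t ∈ I, A μ t = k * A ν t

/-- On `U`, the metric `g` solves Einstein's equations (units `8πG = c = 1`, zero cosmological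
constant) for a perfect fluid with energy density `ρ`, pressure `p` and four-velocity `u`:
`g_{ab} u^a u^b = -1` and `G_{ab} = (ρ + p) u_a u_b + p g_{ab}`, where `u_a = g_{ab} u^b`. -/
def IsPerfectFluid (g : TensorField) (U : Set Event) (ρ p : Event → ℝ) (u : VField) : Prop :=
  ∀ x ∈ U, (∑ a, ∑ b, g x a b * u x a * u x b = -1) ∧
    ∀ a b, einstein g x a b =
      (ρ x + p x) * (∑ c, g x a c * u x c) * (∑ c, g x b c * u x c) + p x * g x a b

/-- `τ` is a primitive `∫ √|R₀₀| dt` of `√|R₀₀|` on `I` (`R₀₀` depends on `t` only). -/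
def IsRicciTime (A : Fin 3 → ℝ → ℝ) (I : Set ℝ) (τ : ℝ → ℝ) : Prop :=
  ∀ x ∈ domain I, HasDerivAt τ (√|ricci (metric A) x 0 0|) (x 0)

/-- The condition on the metric functions
`A_1² / A_ν² = (C_1 / C_ν) exp (2 (c_1 - c_ν) ∫ √|R₀₀| dt)` for `ν = 2, 3`
(the spatial indices `1, 2, 3` are `0, 1, 2` here). -/
def RatioCondition (A : Fin 3 → ℝ → ℝ) (I : Set ℝ) (c C : Fin 3 → ℝ) (τ : ℝ → ℝ) : Prop :=
  (∀ t ∈ I, C 0 / C 1 * Real.exp (2 * (c 0 - c 1) * τ t) = A 0 t ^ 2 / A 1 t ^ 2) ∧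
  (∀ t ∈ I, C 0 / C 2 * Real.exp (2 * (c 0 - c 2) * τ t) = A 0 t ^ 2 / A 2 t ^ 2)

/-- The vector field `|R₀₀|^{-1/2} ∂_0 - ∑_μ c_μ x^μ ∂_μ`. -/
def ricciField (A : Fin 3 → ℝ → ℝ) (c : Fin 3 → ℝ) : VField := fun x =>
  Fin.cons (1 / √|ricci (metric A) x 0 0|) fun μ : Fin 3 => -(c μ * x μ.succ)

end BianchiI

end

namespace BianchiI

/-! Write `H_μ = A_μ'/A_μ` and `θ = ∑ H_μ`. The Ricci tensor is diagonal, and the fluid equations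
make its spatial part isotropic, `R_μμ = q A_μ²`, which means `H_μ' = q - θ H_μ`. Hence `(H_μ - H_ν)
A_1 A_2 A_3` is constant, and properness makes it nonzero (`IsotropicRicci.hubble_ne`). (i) The
ratio condition says `H_μ - H_ν = (c_μ - c_ν) √|R₀₀|`. So `R₀₀' = -2θ R₀₀`, which forces `q' =
-(2/3) θ q`. Therefore `R_μμ` has logarithmic derivative `2 (H_μ - θ/3)`, and `H_μ - θ/3` is
`√|R₀₀|` times the trace-free part of `c_μ`. This is exactly the collineation equation. (ii) Here
`q` and `R₀₀` are constant multiples of `ρ`, and `ρ' = -γ θ ρ`. Cross-differentiating the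
collineation equations gives `H_ν ∂_ν X⁰ = 0`, then `θ X⁰ = 0` (`pd_time_eq_zero`, `time_eq_zero`).
Where `H_ν` or `θ` vanishes its derivative is a nonzero multiple of `q`, so `X⁰ = 0` everywhere.
What remains is the Killing system, since `R_μμ` is proportional to `A_μ²` with a factor common to
all `μ`. -/

variable {A : Fin 3 → ℝ → ℝ} {I : Set ℝ}

/-! ### Partial derivatives on coordinate space. -/

theorem isOpen_domain {I : Set ℝ} (hI : IsOpen I) : IsOpen (domain I) :=
  hI.preimage (continuous_apply 0)

theorem pd_congr {f g : Event → ℝ} {U : Set Event} (hU : IsOpen U) (h : Set.EqOn f g U)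
    {x : Event} (hx : x ∈ U) (a : Fin 4) : pd a f x = pd a g x := by
  have : f =ᶠ[nhds x] g := Filter.eventuallyEq_of_mem (hU.mem_nhds hx) h
  simp only [pd, this.fderiv_eq]

theorem pd_const (a : Fin 4) (k : ℝ) (x : Event) : pd a (fun _ => k) x = 0 := by
  simp [pd]

theorem pd_coord (a b : Fin 4) (x : Event) :
    pd a (fun y => y b) x = if b = a then 1 else 0 := by
  have : HasFDerivAt (fun y : Event => y b)
      (ContinuousLinearMap.proj (R := ℝ) (φ := fun _ : Fin 4 => ℝ) b) x :=
    (ContinuousLinearMap.proj (R := ℝ) (φ := fun _ : Fin 4 => ℝ) b).hasFDerivAt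
  simp [pd, this.fderiv, Pi.single_apply]

theorem differentiableAt_time {F : ℝ → ℝ} {x : Event} (hF : DifferentiableAt ℝ F (x 0)) :
    DifferentiableAt ℝ (fun y : Event => F (y 0)) x :=
  DifferentiableAt.comp (f := fun y : Event => y 0) x hF (differentiableAt_apply 0 x)

theorem pd_time {F : ℝ → ℝ} {F' : ℝ} {x : Event} (hF : HasDerivAt F F' (x 0)) (a : Fin 4) :
    pd a (fun y => F (y 0)) x = if a = 0 then F' else 0 := by
  have h0 : HasFDerivAt (fun y : Event => y 0)
      (ContinuousLinearMap.proj (R := ℝ) (φ := fun _ : Fin 4 => ℝ) 0) x :=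
    (ContinuousLinearMap.proj (R := ℝ) (φ := fun _ : Fin 4 => ℝ) 0).hasFDerivAt
  have := hF.comp_hasFDerivAt x h0
  have h2 : fderiv ℝ (fun y : Event => F (y 0)) x = _ := this.fderiv
  simp [pd, h2, Pi.single_apply, eq_comm]

theorem pd_add {f g : Event → ℝ} {x : Event} (hf : DifferentiableAt ℝ f x)
    (hg : DifferentiableAt ℝ g x) (a : Fin 4) :
    pd a (fun y => f y + g y) x = pd a f x + pd a g x := by
  simp [pd, fderiv_fun_add hf hg]

theorem pd_mul {f g : Event → ℝ} {x : Event} (hf : DifferentiableAt ℝ f x)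
    (hg : DifferentiableAt ℝ g x) (a : Fin 4) :
    pd a (fun y => f y * g y) x = pd a f x * g x + f x * pd a g x := by
  simp [pd, fderiv_fun_mul hf hg]; ring

theorem pd_const_mul {f : Event → ℝ} {x : Event} (hf : DifferentiableAt ℝ f x) (k : ℝ)
    (a : Fin 4) : pd a (fun y => k * f y) x = k * pd a f x := by
  rw [pd_mul (differentiableAt_const k) hf, pd_const]; ring

theorem pd_time_mul {F : ℝ → ℝ} {F' : ℝ} {f : Event → ℝ} {x : Event}
    (hF : HasDerivAt F F' (x 0)) (hf : DifferentiableAt ℝ f x) (a : Fin 4) :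
    pd a (fun y => F (y 0) * f y) x = (if a = 0 then F' * f x else 0) + F (x 0) * pd a f x := by
  rw [pd_mul (differentiableAt_time hF.differentiableAt) hf, pd_time hF]
  split_ifs <;> ring

theorem contDiffOn_pd {f : Event → ℝ} {U : Set Event} (hU : IsOpen U) (hf : ContDiffOn ℝ ∞ f U)
    (a : Fin 4) : ContDiffOn ℝ ∞ (pd a f) U :=
  (hf.fderiv_of_isOpen hU (m := ∞) (by simp)).clm_apply contDiffOn_const

theorem differentiableAt_of_smooth {E : Type*} [NormedAddCommGroup E] [NormedSpace ℝ E]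
    {f : E → ℝ} {U : Set E} (hU : IsOpen U)
    (hf : ContDiffOn ℝ ∞ f U) {x : E} (hx : x ∈ U) : DifferentiableAt ℝ f x :=
  (hf.contDiffAt (hU.mem_nhds hx)).differentiableAt (by simp)

theorem pd_comm {f : Event → ℝ} {U : Set Event} (hU : IsOpen U) (hf : ContDiffOn ℝ ∞ f U)
    {x : Event} (hx : x ∈ U) (a b : Fin 4) : pd a (pd b f) x = pd b (pd a f) x := by
  have hs : IsSymmSndFDerivAt ℝ f x :=
    (hf.contDiffAt (hU.mem_nhds hx)).isSymmSndFDerivAt 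
      (by simpa using WithTop.coe_le_coe.2 (le_top : (2 : ℕ∞) ≤ ⊤))
  have hd : DifferentiableAt ℝ (fderiv ℝ f) x :=
    ((hf.fderiv_of_isOpen hU (m := ∞) (by simp)).contDiffAt (hU.mem_nhds hx)).differentiableAt
      (by simp)
  have key : ∀ c d : Fin 4, pd c (pd d f) x
      = fderiv ℝ (fderiv ℝ f) x (Pi.single c 1) (Pi.single d 1) := by
    intro c d
    have : HasFDerivAt (fun y => fderiv ℝ f y (Pi.single d 1)) _ x :=
      hd.hasFDerivAt.clm_apply (hasFDerivAt_const (Pi.single d 1 : Event) x)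
    show fderiv ℝ (fun y => fderiv ℝ f y (Pi.single d 1)) x _ = _
    rw [this.fderiv]; simp
  rw [key, key, hs]

/-! ### Connection and Ricci tensor of the Bianchi I metric. -/

/-- The Hubble rate `A_μ' / A_μ` of the `μ`-th spatial direction. -/
noncomputable def hubble (A : Fin 3 → ℝ → ℝ) (μ : Fin 3) (t : ℝ) : ℝ := deriv (A μ) t / A μ t

/-- The expansion `∑_μ A_μ' / A_μ`. -/
noncomputable def expansion (A : Fin 3 → ℝ → ℝ) (t : ℝ) : ℝ := ∑ μ, hubble A μ t

theorem IsProperBianchiI.contDiffOn_hubble (hA : IsProperBianchiI A I) (μ : Fin 3) :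
    ContDiffOn ℝ ∞ (hubble A μ) I :=
  ((hA.smooth μ).deriv_of_isOpen hA.isOpen (m := ∞) (by simp)).div (hA.smooth μ) (hA.ne_zero μ)

theorem IsProperBianchiI.contDiffOn_deriv_hubble (hA : IsProperBianchiI A I) (μ : Fin 3) :
    ContDiffOn ℝ ∞ (deriv (hubble A μ)) I :=
  (hA.contDiffOn_hubble μ).deriv_of_isOpen hA.isOpen (m := ∞) (by simp)

theorem IsProperBianchiI.hasDerivAt (hA : IsProperBianchiI A I) (μ : Fin 3) {t : ℝ}
    (ht : t ∈ I) : HasDerivAt (A μ) (hubble A μ t * A μ t) t := by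
  rw [hubble, div_mul_cancel₀ _ (hA.ne_zero μ t ht)]
  exact (differentiableAt_of_smooth hA.isOpen (hA.smooth μ) ht).hasDerivAt

theorem IsProperBianchiI.hasDerivAt_sq (hA : IsProperBianchiI A I) (μ : Fin 3) {t : ℝ}
    (ht : t ∈ I) : HasDerivAt (fun s => A μ s ^ 2) (2 * hubble A μ t * A μ t ^ 2) t :=
  ((hA.hasDerivAt μ ht).pow 2).congr_deriv (by simp; ring)

theorem IsProperBianchiI.hasDerivAt_hubble (hA : IsProperBianchiI A I) (μ : Fin 3) {t : ℝ}
    (ht : t ∈ I) : HasDerivAt (hubble A μ) (deriv (hubble A μ) t) t :=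
  (differentiableAt_of_smooth hA.isOpen (hA.contDiffOn_hubble μ) ht).hasDerivAt

theorem metric_inv {x : Event} (hx : ∀ μ, A μ (x 0) ≠ 0) :
    (metric A x)⁻¹ = Matrix.diagonal (Fin.cons (-1) fun μ : Fin 3 => (A μ (x 0) ^ 2)⁻¹) := by
  apply Matrix.inv_eq_right_inv
  rw [metric, Matrix.diagonal_mul_diagonal, ← Matrix.diagonal_one]
  congr 1; ext a
  refine Fin.cases ?_ (fun μ => ?_) a
  · simp
  · simp [hx μ]

/-- The Christoffel symbols of the Bianchi I metric as functions of time. -/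
noncomputable def timeChristoffel (A : Fin 3 → ℝ → ℝ) (a b c : Fin 4) (t : ℝ) : ℝ :=
  Fin.cases (motive := fun _ => ℝ)
    (if b = c then
      Fin.cases (motive := fun _ => ℝ) 0 (fun μ => hubble A μ t * A μ t ^ 2) b else 0)
    (fun μ => if (b = 0 ∧ c = μ.succ) ∨ (c = 0 ∧ b = μ.succ) then hubble A μ t else 0) a

theorem pd_metric (hA : IsProperBianchiI A I) {x : Event} (hx : x ∈ domain I) (a b c : Fin 4) :
    pd a (fun y => metric A y b c) x = if a = 0 ∧ b = c then
      Fin.cases (motive := fun _ => ℝ) 0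
        (fun μ => 2 * hubble A μ (x 0) * A μ (x 0) ^ 2) b else 0 := by
  by_cases hbc : b = c
  · subst hbc
    refine Fin.cases ?_ (fun μ => ?_) b
    · simp [metric, pd_const]
    · simp only [metric, Matrix.diagonal_apply_eq, Fin.cons_succ]
      rw [pd_time (hA.hasDerivAt_sq μ hx)]
      simp
  · simp [metric, pd_const, hbc]

theorem christoffel_metric (hA : IsProperBianchiI A I) {x : Event} (hx : x ∈ domain I)
    (a b c : Fin 4) : christoffel (metric A) a b c x = timeChristoffel A a b c (x 0) := by
  have h0 := fun μ => hA.ne_zero μ (x 0) hx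
  simp only [christoffel, metric_inv h0, pd_metric hA hx]
  simp only [Matrix.diagonal_apply, ite_mul, zero_mul, Finset.sum_ite_eq, Finset.mem_univ, if_true]
  refine Fin.cases ?_ (fun μ => ?_) a
  · refine Fin.cases ?_ (fun ν => ?_) b
    · simp [timeChristoffel]
    · simp only [timeChristoffel, Fin.cases_zero, Fin.cons_zero, Fin.cases_succ, true_and]
      by_cases hc : ν.succ = c
      · subst hc; simp [Fin.succ_ne_zero]; ring
      · simp [hc]
  · have hm := h0 μ
    simp only [timeChristoffel, Fin.cons_succ, Fin.cases_succ]
    refine Fin.cases ?_ (fun ν => ?_) b <;> refine Fin.cases ?_ (fun l => ?_) c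
    · simp [Fin.succ_ne_zero, (Fin.succ_ne_zero μ).symm]
    · by_cases h : μ = l
      · subst h; simp [Fin.succ_ne_zero]; field_simp
      · simp [h, Fin.succ_ne_zero, eq_comm]
    · by_cases h : μ = ν
      · subst h; simp [Fin.succ_ne_zero]; field_simp
      · simp [h, Fin.succ_ne_zero, eq_comm]
    · simp [Fin.succ_ne_zero]

/-- The time derivatives of `timeChristoffel`. -/
noncomputable def timeChristoffelDeriv (A : Fin 3 → ℝ → ℝ) (a b c : Fin 4) (t : ℝ) : ℝ :=
  Fin.cases (motive := fun _ => ℝ)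
    (if b = c then Fin.cases (motive := fun _ => ℝ) 0
      (fun μ => (deriv (hubble A μ) t + 2 * hubble A μ t ^ 2) * A μ t ^ 2) b else 0)
    (fun μ => if (b = 0 ∧ c = μ.succ) ∨ (c = 0 ∧ b = μ.succ) then deriv (hubble A μ) t else 0) a

theorem hasDerivAt_timeChristoffel (hA : IsProperBianchiI A I) {t : ℝ} (ht : t ∈ I)
    (a b c : Fin 4) :
    HasDerivAt (timeChristoffel A a b c) (timeChristoffelDeriv A a b c t) t := by
  unfold timeChristoffel timeChristoffelDeriv
  refine Fin.cases ?_ (fun μ => ?_) a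
  · simp only [Fin.cases_zero]
    split_ifs
    · refine Fin.cases ?_ (fun μ => ?_) b
      · simpa using hasDerivAt_const t (0 : ℝ)
      · simp only [Fin.cases_succ]
        exact ((hA.hasDerivAt_hubble μ ht).mul (hA.hasDerivAt_sq μ ht)).congr_deriv (by ring)
    · exact hasDerivAt_const t (0 : ℝ)
  · simp only [Fin.cases_succ]
    split_ifs
    · exact hA.hasDerivAt_hubble μ ht
    · exact hasDerivAt_const t (0 : ℝ)

theorem pd_christoffel_metric (hA : IsProperBianchiI A I) {x : Event} (hx : x ∈ domain I)
    (d a b c : Fin 4) : pd d (christoffel (metric A) a b c) x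
      = if d = 0 then timeChristoffelDeriv A a b c (x 0) else 0 := by
  rw [pd_congr (isOpen_domain hA.isOpen)
    (g := fun y => timeChristoffel A a b c (y 0)) (fun y hy => christoffel_metric hA hy a b c) hx,
    pd_time (hasDerivAt_timeChristoffel hA hx a b c)]

/-- The component `R₀₀` of the Ricci tensor of the Bianchi I metric. -/
noncomputable def ricciTime (A : Fin 3 → ℝ → ℝ) (t : ℝ) : ℝ :=
  -∑ μ, (deriv (hubble A μ) t + hubble A μ t ^ 2)

/-- The eigenvalue `A_μ⁻² R_{μμ}` of the Ricci tensor of the Bianchi I metric. -/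
noncomputable def ricciSpace (A : Fin 3 → ℝ → ℝ) (μ : Fin 3) (t : ℝ) : ℝ :=
  deriv (hubble A μ) t + expansion A t * hubble A μ t

theorem ricci_metric (hA : IsProperBianchiI A I) {x : Event} (hx : x ∈ domain I) :
    ricci (metric A) x = Matrix.diagonal (Fin.cons (ricciTime A (x 0))
      fun μ => A μ (x 0) ^ 2 * ricciSpace A μ (x 0)) := by
  ext b c
  simp only [ricci, Matrix.of_apply, pd_christoffel_metric hA hx, christoffel_metric hA hx]
  -- The symbols reduce definitionally at numeral indices; tabulating them lets `simp` evaluate all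
  -- sixteen components.
  have g0 : ∀ c t, timeChristoffel A 0 0 c t = 0 := fun c t => ite_self _
  have g1 : ∀ c t, timeChristoffel A 0 1 c t
      = if 1 = c then hubble A 0 t * A 0 t ^ 2 else 0 := fun c t => rfl
  have g2 : ∀ c t, timeChristoffel A 0 2 c t
      = if 2 = c then hubble A 1 t * A 1 t ^ 2 else 0 := fun c t => rfl
  have g3 : ∀ c t, timeChristoffel A 0 3 c t
      = if 3 = c then hubble A 2 t * A 2 t ^ 2 else 0 := fun c t => rfl
  have k1 : ∀ b c t, timeChristoffel A 1 b c t
      = if (b = 0 ∧ c = 1) ∨ (c = 0 ∧ b = 1) then hubble A 0 t else 0 := fun b c t => rfl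
  have k2 : ∀ b c t, timeChristoffel A 2 b c t
      = if (b = 0 ∧ c = 2) ∨ (c = 0 ∧ b = 2) then hubble A 1 t else 0 := fun b c t => rfl
  have k3 : ∀ b c t, timeChristoffel A 3 b c t
      = if (b = 0 ∧ c = 3) ∨ (c = 0 ∧ b = 3) then hubble A 2 t else 0 := fun b c t => rfl
  have d0 : ∀ c t, timeChristoffelDeriv A 0 0 c t = 0 := fun c t => ite_self _
  have d1 : ∀ c t, timeChristoffelDeriv A 0 1 c t = if 1 = c then
      (deriv (hubble A 0) t + 2 * hubble A 0 t ^ 2) * A 0 t ^ 2 else 0 := fun c t => rfl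
  have d2 : ∀ c t, timeChristoffelDeriv A 0 2 c t = if 2 = c then
      (deriv (hubble A 1) t + 2 * hubble A 1 t ^ 2) * A 1 t ^ 2 else 0 := fun c t => rfl
  have d3 : ∀ c t, timeChristoffelDeriv A 0 3 c t = if 3 = c then
      (deriv (hubble A 2) t + 2 * hubble A 2 t ^ 2) * A 2 t ^ 2 else 0 := fun c t => rfl
  have e1 : ∀ b c t, timeChristoffelDeriv A 1 b c t
      = if (b = 0 ∧ c = 1) ∨ (c = 0 ∧ b = 1) then deriv (hubble A 0) t else 0 := fun b c t => rfl
  have e2 : ∀ b c t, timeChristoffelDeriv A 2 b c t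
      = if (b = 0 ∧ c = 2) ∨ (c = 0 ∧ b = 2) then deriv (hubble A 1) t else 0 := fun b c t => rfl
  have e3 : ∀ b c t, timeChristoffelDeriv A 3 b c t
      = if (b = 0 ∧ c = 3) ∨ (c = 0 ∧ b = 3) then deriv (hubble A 2) t else 0 := fun b c t => rfl
  have f1 : ∀ (r : ℝ) (f : Fin 3 → ℝ), (Fin.cons r f : Fin 4 → ℝ) 1 = f 0 := fun _ _ => rfl
  have f2 : ∀ (r : ℝ) (f : Fin 3 → ℝ), (Fin.cons r f : Fin 4 → ℝ) 2 = f 1 := fun _ _ => rfl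
  have f3 : ∀ (r : ℝ) (f : Fin 3 → ℝ), (Fin.cons r f : Fin 4 → ℝ) 3 = f 2 := fun _ _ => rfl
  fin_cases b <;> fin_cases c <;>
    simp [Fin.sum_univ_four, Fin.sum_univ_three, ricciTime, ricciSpace,
      expansion, g0, g1, g2, g3, k1, k2, k3, d0, d1, d2, d3, e1, e2, e3, f1, f2, f3] <;> ring

theorem eq_of_hasDerivAt_zero (hI : IsOpen I) (hc : I.OrdConnected) {f : ℝ → ℝ}
    (hf : ∀ t ∈ I, HasDerivAt f 0 t) {s t : ℝ} (hs : s ∈ I) (ht : t ∈ I) : f s = f t :=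
  hI.is_const_of_deriv_eq_zero hc.isPreconnected
    (fun x hx => (hf x hx).differentiableAt.differentiableWithinAt)
    (fun x hx => (hf x hx).deriv) hs ht

/-! ### Einstein's equations for a perfect fluid. -/

theorem scalarCurvature_metric (hA : IsProperBianchiI A I) {x : Event} (hx : x ∈ domain I) :
    scalarCurvature (metric A) x = -ricciTime A (x 0) + ∑ μ, ricciSpace A μ (x 0) := by
  have h0 := fun μ => hA.ne_zero μ (x 0) hx
  simp only [scalarCurvature, ricci_metric hA hx, metric_inv h0, Matrix.diagonal_apply, ite_mul,
    zero_mul, Finset.sum_ite_eq, Finset.mem_univ, if_true]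
  simp only [Fin.sum_univ_succ (n := 3), Fin.cons_zero, Fin.cons_succ]
  congr 1
  · ring
  · refine Finset.sum_congr rfl fun μ _ => ?_
    have := h0 μ
    field_simp

theorem einstein_metric_eq_zero (hA : IsProperBianchiI A I) {x : Event} (hx : x ∈ domain I)
    {a b : Fin 4} (hab : a ≠ b) : einstein (metric A) x a b = 0 := by
  simp [einstein, ricci_metric hA hx, metric, hab]

/-- The fluid is not assumed comoving. The normalization forces `u⁰ ≠ 0`, so `G_{0μ} = 0` gives `(ρ
+ p) u^μ = 0`, and every tilt term drops out even when `ρ + p = 0`. -/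
theorem IsPerfectFluid.einstein_eq (hA : IsProperBianchiI A I) {ρ p : Event → ℝ} {u : VField}
    (h : IsPerfectFluid (metric A) (domain I) ρ p u) {x : Event} (hx : x ∈ domain I) :
    einstein (metric A) x 0 0 = ρ x ∧
      ∀ μ : Fin 3, einstein (metric A) x μ.succ μ.succ = p x * A μ (x 0) ^ 2 := by
  have h0 := fun μ => hA.ne_zero μ (x 0) hx
  obtain ⟨hn, hG⟩ := h x hx
  have hlow : ∀ a, ∑ c, metric A x a c * u x c = metric A x a a * u x a := by
    intro a
    simp [metric, Matrix.diagonal_apply]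
  simp only [hlow] at hG
  have hn' : -(u x 0) ^ 2 + ∑ μ : Fin 3, A μ (x 0) ^ 2 * u x μ.succ ^ 2 = -1 := by
    rw [← hn]
    simp only [metric, Matrix.diagonal_apply, ite_mul, zero_mul, Finset.sum_ite_eq,
      Finset.mem_univ, if_true]
    simp only [Fin.sum_univ_succ (n := 3), Fin.cons_zero, Fin.cons_succ]
    congr 1
    · ring
    · exact Finset.sum_congr rfl fun μ _ => by ring
  have hu0 : u x 0 ≠ 0 := by
    intro h
    have : 0 ≤ ∑ μ : Fin 3, A μ (x 0) ^ 2 * u x μ.succ ^ 2 :=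
      Finset.sum_nonneg fun μ _ => by positivity
    rw [h] at hn'
    linarith
  have hui : ∀ μ : Fin 3, (ρ x + p x) * u x μ.succ = 0 := by
    intro μ
    have h1 := hG 0 μ.succ
    rw [einstein_metric_eq_zero hA hx (Fin.succ_ne_zero μ).symm] at h1
    simp only [metric, Matrix.diagonal_apply_eq, Fin.cons_zero, Fin.cons_succ,
      Matrix.diagonal_apply_ne _ (Fin.succ_ne_zero μ).symm, mul_zero, add_zero] at h1
    have h2 : u x 0 * A μ (x 0) ^ 2 * ((ρ x + p x) * u x μ.succ) = 0 := by linarith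
    exact (mul_eq_zero.1 h2).resolve_left (mul_ne_zero hu0 (pow_ne_zero 2 (h0 μ)))
  refine ⟨?_, fun μ => ?_⟩
  · have hs : (ρ x + p x) * ∑ μ : Fin 3, A μ (x 0) ^ 2 * u x μ.succ ^ 2 = 0 := by
      rw [Finset.mul_sum]
      refine Finset.sum_eq_zero fun μ _ => ?_
      linear_combination A μ (x 0) ^ 2 * u x μ.succ * hui μ
    rw [hG 0 0]
    simp only [metric, Matrix.diagonal_apply_eq, Fin.cons_zero]
    linear_combination -(ρ x + p x) * hn' + hs
  · rw [hG]
    simp only [metric, Matrix.diagonal_apply_eq, Fin.cons_succ]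
    linear_combination A μ (x 0) ^ 4 * u x μ.succ * hui μ

/-- The density of a Bianchi I perfect fluid as a function of time. -/
noncomputable def density (A : Fin 3 → ℝ → ℝ) (t : ℝ) : ℝ :=
  (expansion A t ^ 2 - ∑ μ, hubble A μ t ^ 2) / 2

theorem IsPerfectFluid.field_equations (hA : IsProperBianchiI A I) {ρ p : Event → ℝ} {u : VField}
    (h : IsPerfectFluid (metric A) (domain I) ρ p u) {x : Event} (hx : x ∈ domain I) :
    (∀ μ, ricciSpace A μ (x 0) = (ρ x - p x) / 2) ∧ ricciTime A (x 0) = (ρ x + 3 * p x) / 2 ∧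
      ρ x = density A (x 0) := by
  obtain ⟨h1, h2⟩ := h.einstein_eq hA hx
  have h0 := fun μ => hA.ne_zero μ (x 0) hx
  simp only [einstein, Matrix.sub_apply, Matrix.smul_apply, ricci_metric hA hx,
    scalarCurvature_metric hA hx, metric, Matrix.diagonal_apply_eq, Fin.cons_zero, Fin.cons_succ,
    smul_eq_mul] at h1 h2
  have h3 : ∀ μ, ricciSpace A μ (x 0)
      - (-ricciTime A (x 0) + ∑ μ, ricciSpace A μ (x 0)) / 2 = p x := fun μ =>
    mul_left_cancel₀ (pow_ne_zero 2 (h0 μ)) (by linear_combination h2 μ)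
  have e0 := h3 0
  have e1 := h3 1
  have e2 := h3 2
  rw [Fin.sum_univ_three] at e0 e1 e2 h1
  refine ⟨fun μ => ?_, by linarith, ?_⟩
  · fin_cases μ <;> simp only [Fin.zero_eta, Fin.mk_one, Fin.reduceFinMk] <;> linarith
  -- The Hamiltonian constraint: second derivatives of `A` cancel in `G₀₀`.
  · rw [← h1]
    simp only [density, ricciTime, ricciSpace, expansion, Fin.sum_univ_three]
    ring

theorem IsPerfectFluid.ricciSpace_eq (hA : IsProperBianchiI A I) {ρ p : Event → ℝ} {u : VField}
    (h : IsPerfectFluid (metric A) (domain I) ρ p u) {t : ℝ} (ht : t ∈ I) (μ : Fin 3) :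
    ricciSpace A μ t = ricciSpace A 0 t :=
  have h1 := (h.field_equations hA (x := fun _ => t) ht).1
  (h1 μ).trans (h1 0).symm

/-! ### Evolution of the Hubble rates under an isotropic spatial Ricci tensor. -/

/-- The spatial part of the Ricci tensor is isotropic: `R_{μμ} = A_μ² q` with `q` independent
of `μ`. -/
def IsotropicRicci (A : Fin 3 → ℝ → ℝ) (I : Set ℝ) : Prop :=
  ∀ t ∈ I, ∀ μ, ricciSpace A μ t = ricciSpace A 0 t

theorem IsotropicRicci.hasDerivAt_hubble (hq : IsotropicRicci A I) (hA : IsProperBianchiI A I)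
    {t : ℝ} (ht : t ∈ I) (μ : Fin 3) :
    HasDerivAt (hubble A μ) (ricciSpace A 0 t - expansion A t * hubble A μ t) t := by
  refine (hA.hasDerivAt_hubble μ ht).congr_deriv ?_
  rw [← hq t ht μ, ricciSpace]; ring

theorem IsotropicRicci.hasDerivAt_expansion (hq : IsotropicRicci A I) (hA : IsProperBianchiI A I)
    {t : ℝ} (ht : t ∈ I) :
    HasDerivAt (expansion A) (3 * ricciSpace A 0 t - expansion A t ^ 2) t := by
  have := HasDerivAt.fun_sum (u := Finset.univ) fun μ _ => hq.hasDerivAt_hubble hA ht μ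
  refine this.congr_deriv ?_
  simp only [Fin.sum_univ_three, expansion]; ring

/-- Both rates satisfy the same linear equation with the same source, so their difference times the
volume `A_1 A_2 A_3` is constant. One zero would make the rates agree on all of `I`, and then `A_μ /
A_ν` would be constant. -/
theorem IsotropicRicci.hubble_ne (hq : IsotropicRicci A I) (hA : IsProperBianchiI A I)
    {t : ℝ} (ht : t ∈ I) {μ ν : Fin 3} (hμν : μ ≠ ν) : hubble A μ t ≠ hubble A ν t := by
  intro heq
  have hne := hA.ne_zero
  have hconst : ∀ s ∈ I, hubble A μ s = hubble A ν s := by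
    intro s hs
    have hd : ∀ r ∈ I,
        HasDerivAt (fun r => (hubble A μ r - hubble A ν r) * (A 0 r * A 1 r * A 2 r)) 0 r := by
      intro r hr
      refine (((hq.hasDerivAt_hubble hA hr μ).sub (hq.hasDerivAt_hubble hA hr ν)).mul
        (((hA.hasDerivAt 0 hr).mul (hA.hasDerivAt 1 hr)).mul (hA.hasDerivAt 2 hr))).congr_deriv ?_
      simp only [expansion, Fin.sum_univ_three, Pi.sub_apply, Pi.mul_apply]; ring
    have h1 := eq_of_hasDerivAt_zero hA.isOpen hA.ordConnected hd hs ht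
    simp only [heq, sub_self, zero_mul] at h1
    exact sub_eq_zero.1 ((mul_eq_zero.1 h1).resolve_right
      (mul_ne_zero (mul_ne_zero (hne 0 s hs) (hne 1 s hs)) (hne 2 s hs)))
  refine hA.not_proportional μ ν hμν ⟨A μ t / A ν t, fun s hs => ?_⟩
  have hd : ∀ r ∈ I, HasDerivAt (fun r => A μ r / A ν r) 0 r := by
    intro r hr
    refine ((hA.hasDerivAt μ hr).div (hA.hasDerivAt ν hr) (hne ν r hr)).congr_deriv ?_
    rw [hconst r hr]; ring
  have := eq_of_hasDerivAt_zero hA.isOpen hA.ordConnected hd ht hs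
  rw [this, div_mul_cancel₀ _ (hne ν s hs)]

/-- Eliminates the derivatives of the rates, so that differentiating `R₀₀` yields an equation for
`q'`. -/
theorem ricciTime_eq (hq : IsotropicRicci A I) {t : ℝ} (ht : t ∈ I) :
    ricciTime A t
      = -(3 * ricciSpace A 0 t - expansion A t ^ 2 + ∑ μ, hubble A μ t ^ 2) := by
  have h0 := hq t ht
  have h1 : ∀ μ, deriv (hubble A μ) t = ricciSpace A 0 t - expansion A t * hubble A μ t := by
    intro μ; rw [← h0 μ, ricciSpace]; ring
  simp only [ricciTime, h1, expansion, Fin.sum_univ_three]; ring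

theorem contDiffOn_ricciTime (hA : IsProperBianchiI A I) : ContDiffOn ℝ ∞ (ricciTime A) I :=
  (ContDiffOn.sum fun μ _ => (hA.contDiffOn_deriv_hubble μ).add
    ((hA.contDiffOn_hubble μ).pow 2)).neg

theorem contDiffOn_ricciSpace (hA : IsProperBianchiI A I) (μ : Fin 3) :
    ContDiffOn ℝ ∞ (ricciSpace A μ) I :=
  (hA.contDiffOn_deriv_hubble μ).add
    ((ContDiffOn.sum fun ν _ => hA.contDiffOn_hubble ν).mul (hA.contDiffOn_hubble μ))

/-! ### Part (i): the explicit collineation. -/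

theorem hasDerivAt_inv_sqrt_abs {r : ℝ → ℝ} {r' t : ℝ} (h : HasDerivAt r r' t) (h0 : r t ≠ 0) :
    HasDerivAt (fun s => 1 / √|r s|) (-(r' / (2 * r t)) * (1 / √|r t|)) t := by
  have hpos : 0 < √|r t| := Real.sqrt_pos.2 (abs_pos.2 h0)
  have hsq : √|r t| ^ 2 = |r t| := Real.sq_sqrt (abs_nonneg _)
  have habs : HasDerivAt (fun s => |r s|) (SignType.sign (r t) * r') t :=
    (hasDerivAt_abs h0).comp t h
  have h1 := (habs.sqrt (abs_ne_zero.2 h0)).inv hpos.ne'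
  simp only [one_div]
  refine h1.congr_deriv ?_
  rw [hsq]
  rcases h0.lt_or_gt with hn | hp
  · rw [abs_of_neg hn] at *
    simp only [hn, sign_neg, SignType.coe_neg_one]
    field_simp
  · rw [abs_of_pos hp] at *
    simp only [hp, sign_pos, SignType.coe_one]
    field_simp

theorem pd_ricci (hA : IsProperBianchiI A I) {x : Event} (hx : x ∈ domain I) (c a b : Fin 4) :
    pd c (fun y => ricci (metric A) y a b) x = if c = 0 ∧ a = b then
      Fin.cases (motive := fun _ => ℝ) (deriv (ricciTime A) (x 0))
        (fun μ => A μ (x 0) ^ 2 * (deriv (ricciSpace A μ) (x 0)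
          + 2 * hubble A μ (x 0) * ricciSpace A μ (x 0))) a else 0 := by
  rw [pd_congr (isOpen_domain hA.isOpen) (g := fun y => Matrix.diagonal (Fin.cons
      (ricciTime A (y 0)) fun μ => A μ (y 0) ^ 2 * ricciSpace A μ (y 0)) a b)
    (fun y hy => by simp only [ricci_metric hA hy]) hx]
  by_cases hab : a = b
  · subst hab
    refine Fin.cases ?_ (fun μ => ?_) a
    · simp only [Matrix.diagonal_apply_eq, Fin.cons_zero]
      rw [pd_time (differentiableAt_of_smooth hA.isOpen (contDiffOn_ricciTime hA) hx).hasDerivAt]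
      simp
    · simp only [Matrix.diagonal_apply_eq, Fin.cons_succ]
      rw [pd_time (F := fun t => A μ t ^ 2 * ricciSpace A μ t) ((hA.hasDerivAt_sq μ hx).mul
        (differentiableAt_of_smooth hA.isOpen (contDiffOn_ricciSpace hA μ) hx).hasDerivAt)]
      simp only [and_true, Fin.cases_succ]
      congr 1; ring
  · simp [hab, pd_const]

/-- The Lie derivative of the Ricci tensor of the Bianchi I metric. -/
theorem lieDeriv_ricci (hA : IsProperBianchiI A I) {x : Event} (hx : x ∈ domain I) (X : VField)
    (a b : Fin 4) :
    lieDeriv X (ricci (metric A)) a b x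
      = X x 0 * pd 0 (fun y => ricci (metric A) y a b) x
        + ricci (metric A) x b b * pd a (fun y => X y b) x
        + ricci (metric A) x a a * pd b (fun y => X y a) x := by
  simp only [lieDeriv, Finset.sum_add_distrib]
  congr 1
  · congr 1
    · rw [Finset.sum_eq_single 0]
      · intro c _ hc; simp [pd_ricci hA hx, hc]
      · simp
    · rw [Finset.sum_eq_single b]
      · intro c _ hc; simp [ricci_metric hA hx, hc]
      · simp
  · rw [Finset.sum_eq_single a]
    · intro c _ hc; simp [ricci_metric hA hx, hc.symm]
    · simp

theorem ricci_metric_zero (hA : IsProperBianchiI A I) {x : Event} (hx : x ∈ domain I) :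
    ricci (metric A) x 0 0 = ricciTime A (x 0) := by
  simp [ricci_metric hA hx]

theorem ricci_metric_succ (hA : IsProperBianchiI A I) {x : Event} (hx : x ∈ domain I)
    (μ : Fin 3) :
    ricci (metric A) x μ.succ μ.succ = A μ (x 0) ^ 2 * ricciSpace A μ (x 0) := by
  simp [ricci_metric hA hx]

theorem pd_ricciField_zero (hA : IsProperBianchiI A I) {x : Event} (hx : x ∈ domain I)
    (h0 : ricciTime A (x 0) ≠ 0) (c : Fin 3 → ℝ) (a : Fin 4) :
    pd a (fun y => ricciField A c y 0) x = if a = 0 then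
      -(deriv (ricciTime A) (x 0) / (2 * ricciTime A (x 0))) * (1 / √|ricciTime A (x 0)|)
      else 0 := by
  rw [pd_congr (isOpen_domain hA.isOpen) (g := fun y => 1 / √|ricciTime A (y 0)|)
    (fun y hy => by simp [ricciField, ricci_metric_zero hA hy]) hx]
  exact pd_time (F := fun t => 1 / √|ricciTime A t|) (hasDerivAt_inv_sqrt_abs
    (differentiableAt_of_smooth hA.isOpen (contDiffOn_ricciTime hA) hx).hasDerivAt h0) a

theorem pd_ricciField_succ (x : Event) (c : Fin 3 → ℝ) (a : Fin 4) (μ : Fin 3) :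
    pd a (fun y => ricciField A c y μ.succ) x = if μ.succ = a then -c μ else 0 := by
  have : (fun y : Event => ricciField A c y μ.succ) = fun y => -c μ * y μ.succ := by
    ext y; simp [ricciField]
  rw [this, pd_const_mul (differentiableAt_apply _ _), pd_coord]
  simp

/-- `ricciField A c` is a Ricci collineation as soon as the spatial Ricci components satisfy
`∂_t R_{μμ} = 2 c_μ √|R₀₀| R_{μμ}`. -/
theorem isRicciCollineation_ricciField (hA : IsProperBianchiI A I)
    (h0 : ∀ t ∈ I, ricciTime A t ≠ 0) (c : Fin 3 → ℝ)
    (h : ∀ t ∈ I, ∀ μ, deriv (ricciSpace A μ) t + 2 * hubble A μ t * ricciSpace A μ t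
      = 2 * c μ * √|ricciTime A t| * ricciSpace A μ t) :
    IsRicciCollineation (metric A) (domain I) (ricciField A c) := by
  refine ⟨?_, fun x hx a b => ?_⟩
  · rw [contDiffOn_pi]
    intro a
    refine Fin.cases ?_ (fun μ => ?_) a
    · have hr : ContDiffOn ℝ ∞ (fun x : Event => ricciTime A (x 0)) (domain I) :=
        (contDiffOn_ricciTime hA).comp (contDiff_apply ℝ ℝ 0).contDiffOn fun x hx => hx
      have habs : ContDiffOn ℝ ∞ (fun x : Event => |ricciTime A (x 0)|) (domain I) :=
        hr.abs fun x hx => h0 _ hx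
      refine ContDiffOn.congr (f := fun x : Event => 1 / √|ricciTime A (x 0)|) ?_ ?_
      · exact contDiffOn_const.div (habs.sqrt fun x hx => abs_ne_zero.2 (h0 _ hx))
          fun x hx => (Real.sqrt_pos.2 (abs_pos.2 (h0 _ hx))).ne'
      · intro x hx; simp [ricciField, ricci_metric_zero hA hx]
    · simp only [ricciField, Fin.cons_succ]
      exact (contDiff_const.mul (contDiff_apply ℝ ℝ μ.succ)).neg.contDiffOn
  · have hr := h0 _ hx
    have hs : √|ricciTime A (x 0)| ≠ 0 := (Real.sqrt_pos.2 (abs_pos.2 hr)).ne'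
    have hX : ricciField A c x 0 = 1 / √|ricciTime A (x 0)| := by
      simp [ricciField, ricci_metric_zero hA hx]
    rw [lieDeriv_ricci hA hx, pd_ricci hA hx, hX]
    refine Fin.cases ?_ (fun μ => ?_) a <;> refine Fin.cases ?_ (fun ν => ?_) b
    -- `R₀₀' X⁰ + 2 R₀₀ ∂₀X⁰ = 0` is solved by `X⁰ = |R₀₀|^{-1/2}` for any `c`.
    · simp only [pd_ricciField_zero hA hx hr, ricci_metric_zero hA hx, and_self, if_true,
        Fin.cases_zero]
      field_simp; ring
    · simp [pd_ricciField_zero hA hx hr, pd_ricciField_succ, Fin.succ_ne_zero,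
        (Fin.succ_ne_zero ν).symm]
    · simp [pd_ricciField_zero hA hx hr, pd_ricciField_succ, Fin.succ_ne_zero]
    · simp only [pd_ricciField_succ, ricci_metric_succ hA hx, true_and, Fin.succ_inj,
        Fin.cases_succ]
      by_cases hμν : μ = ν
      · subst hμν
        simp only [if_true, h _ hx μ]
        field_simp; ring
      · simp [hμν, Ne.symm hμν]

/-- In the time `τ` the Ricci tensor reads `±dτ² + ∑ C_μ e^{2 c_μ τ} (dx^μ)²`. Shifting `τ` by `s`
while scaling `x^μ` by `e^{-c_μ s}` preserves it. -/
theorem isRicciCollineation_of_exponents (hA : IsProperBianchiI A I)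
    (h0 : ∀ x ∈ domain I, ricci (metric A) x 0 0 ≠ 0) {c C : Fin 3 → ℝ} {τ : ℝ → ℝ}
    (hτ : IsRicciTime A I τ)
    (h : ∀ x ∈ domain I, ∀ μ : Fin 3,
      ricci (metric A) x μ.succ μ.succ = C μ * Real.exp (2 * c μ * τ (x 0))) :
    IsRicciCollineation (metric A) (domain I) (ricciField A c) := by
  have h0' : ∀ t ∈ I, ricciTime A t ≠ 0 := fun t ht => by
    have := h0 (fun _ => t) ht
    rwa [ricci_metric_zero hA ht] at this
  refine isRicciCollineation_ricciField hA h0' c fun t ht μ => ?_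
  have hx : (fun _ => t : Event) ∈ domain I := ht
  have hτ' := hτ _ hx
  rw [ricci_metric_zero hA hx] at hτ'
  have h1 := ((hA.hasDerivAt_sq μ ht).mul
    (differentiableAt_of_smooth hA.isOpen (contDiffOn_ricciSpace hA μ) ht).hasDerivAt)
  have h2 := ((hτ'.const_mul (2 * c μ)).exp.const_mul (C μ))
  have hev : (fun s => A μ s ^ 2 * ricciSpace A μ s) =ᶠ[nhds t]
      fun s => C μ * Real.exp (2 * c μ * τ s) :=
    Filter.eventuallyEq_of_mem (hA.isOpen.mem_nhds ht) fun s hs => by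
      have := h (fun _ => s) hs μ
      rwa [ricci_metric_succ hA hs] at this
  have h3 := (h1.congr_of_eventuallyEq hev.symm).unique h2
  have h4 := hev.self_of_nhds
  apply mul_left_cancel₀ (pow_ne_zero 2 (hA.ne_zero μ t ht))
  simp only at h3 h4
  linear_combination h3 - 2 * c μ * √|ricciTime A t| * h4

/-- The logarithmic derivative of the ratio condition. -/
theorem IsRicciTime.hubble_sub (hA : IsProperBianchiI A I) {τ : ℝ → ℝ} (hτ : IsRicciTime A I τ)
    {μ ν : Fin 3} {k K : ℝ}
    (h : ∀ t ∈ I, K * Real.exp (2 * k * τ t) = A μ t ^ 2 / A ν t ^ 2) {t : ℝ} (ht : t ∈ I) :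
    hubble A μ t - hubble A ν t = k * √|ricciTime A t| := by
  have hx : (fun _ => t : Event) ∈ domain I := ht
  have hτ' := hτ _ hx
  rw [ricci_metric_zero hA hx] at hτ'
  have hμ := hA.ne_zero μ t ht
  have hν := hA.ne_zero ν t ht
  have h1 := (hA.hasDerivAt_sq μ ht).div (hA.hasDerivAt_sq ν ht) (pow_ne_zero 2 hν)
  have h2 := ((hτ'.const_mul (2 * k)).exp.const_mul K)
  have hev : (fun s => K * Real.exp (2 * k * τ s)) =ᶠ[nhds t] fun s => A μ s ^ 2 / A ν s ^ 2 :=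
    Filter.eventuallyEq_of_mem (hA.isOpen.mem_nhds ht) h
  have h3 := (h2.congr_of_eventuallyEq hev.symm).unique h1
  have h4 := h t ht
  have h5 : A μ t ^ 2 / A ν t ^ 2 * (2 * (k * √|ricciTime A t|))
      = A μ t ^ 2 / A ν t ^ 2 * (2 * (hubble A μ t - hubble A ν t)) := by
    have : (2 * hubble A μ t * A μ t ^ 2 * A ν t ^ 2 - A μ t ^ 2 * (2 * hubble A ν t * A ν t ^ 2))
        / (A ν t ^ 2) ^ 2 = A μ t ^ 2 / A ν t ^ 2 * (2 * (hubble A μ t - hubble A ν t)) := by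
      field_simp
    rw [← this, ← h3, ← h4]; ring
  have := mul_left_cancel₀ (div_ne_zero (pow_ne_zero 2 hμ) (pow_ne_zero 2 hν)) h5
  linarith

theorem isRicciCollineation_of_ratioCondition (hA : IsProperBianchiI A I)
    (hq : IsotropicRicci A I) (h0 : ∀ x ∈ domain I, ricci (metric A) x 0 0 ≠ 0)
    {c C : Fin 3 → ℝ} {τ : ℝ → ℝ} (hτ : IsRicciTime A I τ) (hc : RatioCondition A I c C τ) :
    IsRicciCollineation (metric A) (domain I)
      (ricciField A fun μ => c μ - (c 0 + c 1 + c 2) / 3) := by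
  have h0' : ∀ t ∈ I, ricciTime A t ≠ 0 := fun t ht => by
    have := h0 (fun _ => t) ht
    rwa [ricci_metric_zero hA ht] at this
  have d1 : ∀ t ∈ I, hubble A 0 t - hubble A 1 t = (c 0 - c 1) * √|ricciTime A t| :=
    fun t ht => hτ.hubble_sub hA hc.1 ht
  have d2 : ∀ t ∈ I, hubble A 0 t - hubble A 2 t = (c 0 - c 2) * √|ricciTime A t| :=
    fun t ht => hτ.hubble_sub hA hc.2 ht
  refine isRicciCollineation_ricciField hA h0' _ fun t ht μ => ?_
  -- Equal exponents would make two Hubble rates coincide.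
  have hk : c 0 - c 1 ≠ 0 := by
    intro h
    have := d1 t ht
    rw [h, zero_mul, sub_eq_zero] at this
    exact hq.hubble_ne hA ht (by decide) this
  have hr := (differentiableAt_of_smooth hA.isOpen (contDiffOn_ricciTime hA) ht).hasDerivAt
  have hQ := (differentiableAt_of_smooth hA.isOpen (contDiffOn_ricciSpace hA 0) ht).hasDerivAt
  -- Fourth powers remove the square root and the absolute value, so the sign of `R₀₀` plays no
  -- role.
  have hrsq : ∀ s ∈ I, (c 0 - c 1) ^ 4 * ricciTime A s ^ 2
      = (hubble A 0 s - hubble A 1 s) ^ 4 := by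
    intro s hs
    have : √|ricciTime A s| ^ 2 = |ricciTime A s| := Real.sq_sqrt (abs_nonneg _)
    rw [d1 s hs, mul_pow, ← sq_abs (ricciTime A s)]
    linear_combination -(c 0 - c 1) ^ 4 * (√|ricciTime A s| ^ 2 + |ricciTime A s|) * this
  -- From `(H_1 - H_2)' = -θ (H_1 - H_2)`.
  have hr' : deriv (ricciTime A) t = -2 * expansion A t * ricciTime A t := by
    have h1 := (hr.pow 2).const_mul ((c 0 - c 1) ^ 4)
    have h2 := ((hq.hasDerivAt_hubble hA ht 0).sub (hq.hasDerivAt_hubble hA ht 1)).pow 4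
    have hev : (fun s => (c 0 - c 1) ^ 4 * ricciTime A s ^ 2) =ᶠ[nhds t]
        fun s => (hubble A 0 s - hubble A 1 s) ^ 4 :=
      Filter.eventuallyEq_of_mem (hA.isOpen.mem_nhds ht) hrsq
    have h3 := (h1.congr_of_eventuallyEq hev.symm).unique h2
    have h4 := hrsq t ht
    apply mul_left_cancel₀ (mul_ne_zero (pow_ne_zero 4 hk) (h0' t ht))
    simp only [Pi.sub_apply, Nat.cast_ofNat] at h3
    linear_combination h3 / 2 + 2 * expansion A t * h4
  -- In general `R₀₀' = -2θ R₀₀ - 3q' - 2θ q`; comparing with `hr'` gives `q'`.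
  have hq' : deriv (ricciSpace A 0) t = -(2 / 3) * expansion A t * ricciSpace A 0 t := by
    have h2 := (((hQ.const_mul 3).sub ((hq.hasDerivAt_expansion hA ht).pow 2)).add
      (HasDerivAt.fun_sum (u := Finset.univ) fun ν _ =>
        (hq.hasDerivAt_hubble hA ht ν).pow 2)).neg
    have hev : ricciTime A =ᶠ[nhds t] _ :=
      Filter.eventuallyEq_of_mem (hA.isOpen.mem_nhds ht) fun s hs => ricciTime_eq hq hs
    have h3 := (hr.congr_of_eventuallyEq hev.symm).unique h2
    rw [hr', ricciTime_eq hq ht] at h3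
    simp only [Fin.sum_univ_three, expansion] at h3 ⊢
    linear_combination (1 / 3) * h3
  have hdq : deriv (ricciSpace A μ) t = deriv (ricciSpace A 0) t :=
    Filter.EventuallyEq.deriv_eq
      (Filter.eventuallyEq_of_mem (hA.isOpen.mem_nhds ht) fun s hs => hq s hs μ)
  -- Averaging the differences over the second index produces the trace-free parts on both sides.
  -- This is where the normalization of zero sum enters.
  have hH : hubble A μ t - expansion A t / 3
      = (c μ - (c 0 + c 1 + c 2) / 3) * √|ricciTime A t| := by
    have e1 := d1 t ht
    have e2 := d2 t ht
    simp only [expansion, Fin.sum_univ_three]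
    fin_cases μ <;> simp only [Fin.zero_eta, Fin.mk_one, Fin.reduceFinMk]
    · linear_combination (e1 + e2) / 3
    · linear_combination (-2 * e1 + e2) / 3
    · linear_combination (e1 - 2 * e2) / 3
  rw [hdq, hq', hq t ht μ]
  linear_combination 2 * ricciSpace A 0 t * hH

/-! ### Part (ii): integrability conditions of the collineation equations. -/

/-- If `F(t) f = 0` on an open set and `F' ≠ 0` wherever `F = 0`, then `f = 0`. -/
theorem eq_zero_of_time_mul_eq_zero {F F' : ℝ → ℝ} {f : Event → ℝ} {U : Set Event}
    (hU : IsOpen U) (hf : ContDiffOn ℝ ∞ f U) (hF : ∀ x ∈ U, HasDerivAt F (F' (x 0)) (x 0))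
    (h : ∀ x ∈ U, F (x 0) * f x = 0) (hne : ∀ x ∈ U, F (x 0) = 0 → F' (x 0) ≠ 0) :
    ∀ x ∈ U, f x = 0 := by
  intro x hx
  by_cases hF0 : F (x 0) = 0
  -- At a zero of `F`, the time derivative of `F f = 0` reduces to `F' f = 0`.
  · have h1 := pd_congr hU (f := fun y => F (y 0) * f y) (g := fun _ => 0) h hx 0
    rw [pd_time_mul (hF x hx) (differentiableAt_of_smooth hU hf hx), pd_const, hF0] at h1
    simp only [if_true, zero_mul, add_zero] at h1
    exact (mul_eq_zero.1 h1).resolve_left (hne x hx hF0)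
  · exact (mul_eq_zero.1 (h x hx)).resolve_left hF0

/-- The logarithmic rate `½ (log |R_{μμ}|)'` of a spatial Ricci component when the density scales
as `ρ' = -γ θ ρ`. -/
noncomputable def ricciRate (A : Fin 3 → ℝ → ℝ) (γ : ℝ) (μ : Fin 3) (t : ℝ) : ℝ :=
  hubble A μ t - γ / 2 * expansion A t

/-- The combination `w_μ' + (γ / 2) θ w_μ` of the rate `w_μ = ricciRate A γ μ`. -/
noncomputable def ricciRateFlow (A : Fin 3 → ℝ → ℝ) (γ : ℝ) (μ : Fin 3) (t : ℝ) : ℝ :=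
  deriv (ricciRate A γ μ) t + γ / 2 * expansion A t * ricciRate A γ μ t

theorem IsotropicRicci.hasDerivAt_ricciRate (hq : IsotropicRicci A I) (hA : IsProperBianchiI A I)
    {t : ℝ} (ht : t ∈ I) (γ : ℝ) (μ : Fin 3) :
    HasDerivAt (ricciRate A γ μ) (ricciSpace A 0 t - expansion A t * hubble A μ t
      - γ / 2 * (3 * ricciSpace A 0 t - expansion A t ^ 2)) t :=
  (hq.hasDerivAt_hubble hA ht μ).sub ((hq.hasDerivAt_expansion hA ht).const_mul _)

theorem IsotropicRicci.ricciRateFlow_eq (hq : IsotropicRicci A I) (hA : IsProperBianchiI A I)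
    {t : ℝ} (ht : t ∈ I) (γ : ℝ) (μ : Fin 3) :
    ricciRateFlow A γ μ t = ricciSpace A 0 t - expansion A t * hubble A μ t
      - γ / 2 * (3 * ricciSpace A 0 t - expansion A t ^ 2)
      + γ / 2 * expansion A t * (hubble A μ t - γ / 2 * expansion A t) := by
  rw [ricciRateFlow, (hq.hasDerivAt_ricciRate hA ht γ μ).deriv, ricciRate]

/-- The Ricci collineation equations of a Bianchi I perfect fluid with linear equation of state,
for the time component `f` and the spatial components `ψ μ`, where `k = R₀₀ A_μ² / R_{μμ}`. -/
structure CollineationEquations (A : Fin 3 → ℝ → ℝ) (γ k : ℝ) (U : Set Event) (f : Event → ℝ)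
    (ψ : Fin 3 → Event → ℝ) : Prop where
  smooth_time : ContDiffOn ℝ ∞ f U
  smooth_space : ∀ μ, ContDiffOn ℝ ∞ (ψ μ) U
  time_time : ∀ x ∈ U, pd 0 f x = γ / 2 * expansion A (x 0) * f x
  time_space : ∀ x ∈ U, ∀ μ, A μ (x 0) ^ 2 * pd 0 (ψ μ) x = -k * pd μ.succ f x
  diagonal : ∀ x ∈ U, ∀ μ, pd μ.succ (ψ μ) x = -ricciRate A γ μ (x 0) * f x
  space_space : ∀ x ∈ U, ∀ μ ν, μ ≠ ν →
    A μ (x 0) ^ 2 * pd ν.succ (ψ μ) x + A ν (x 0) ^ 2 * pd μ.succ (ψ ν) x = 0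

namespace CollineationEquations

variable {γ k : ℝ} {U : Set Event} {f : Event → ℝ} {ψ : Fin 3 → Event → ℝ}

theorem pd_succ_time_space (h : CollineationEquations A γ k U f ψ) (hA : IsProperBianchiI A I)
    (hU : IsOpen U) (hUI : U ⊆ domain I) {x : Event} (hx : x ∈ U) (μ ν : Fin 3) :
    A μ (x 0) ^ 2 * pd 0 (pd ν.succ (ψ μ)) x = -k * pd ν.succ (pd μ.succ f) x := by
  have h1 := pd_congr hU (f := fun y => A μ (y 0) ^ 2 * pd 0 (ψ μ) y)
    (fun y hy => h.time_space y hy μ) hx ν.succ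
  rw [pd_time_mul (F := fun t => A μ t ^ 2) (hA.hasDerivAt_sq μ (hUI hx))
      (differentiableAt_of_smooth hU (contDiffOn_pd hU (h.smooth_space μ) 0) hx),
    pd_const_mul (differentiableAt_of_smooth hU (contDiffOn_pd hU h.smooth_time _) hx),
    pd_comm hU (h.smooth_space μ) hx] at h1
  simpa [Fin.succ_ne_zero] using h1

/-- Equate `∂_0 ∂_μ ψ_μ` computed from `diagonal` and from `time_space`. -/
theorem pd_pd_time (h : CollineationEquations A γ k U f ψ) (hA : IsProperBianchiI A I)
    (hq : IsotropicRicci A I) (hU : IsOpen U) (hUI : U ⊆ domain I) {x : Event} (hx : x ∈ U)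
    (μ : Fin 3) :
    k * pd μ.succ (pd μ.succ f) x = A μ (x 0) ^ 2 * ricciRateFlow A γ μ (x 0) * f x := by
  have h1 := pd_congr hU (f := pd μ.succ (ψ μ))
    (g := fun y => -ricciRate A γ μ (y 0) * f y) (fun y hy => h.diagonal y hy μ) hx 0
  rw [pd_time_mul (F := fun t => -ricciRate A γ μ t)
      (hq.hasDerivAt_ricciRate hA (hUI hx) γ μ).differentiableAt.hasDerivAt.neg
      (differentiableAt_of_smooth hU h.smooth_time hx), h.time_time x hx, if_pos rfl] at h1
  have h2 := h.pd_succ_time_space hA hU hUI hx μ μ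
  rw [h1] at h2
  rw [ricciRateFlow]
  linear_combination h2

/-- The time derivative of `space_space`, with `time_space` replacing the mixed derivatives. The
remaining `ψ` terms combine through `space_space` itself. -/
theorem hubble_sub_mul (h : CollineationEquations A γ k U f ψ) (hA : IsProperBianchiI A I)
    (hU : IsOpen U) (hUI : U ⊆ domain I) {x : Event} (hx : x ∈ U)
    {μ ν : Fin 3} (hμν : μ ≠ ν) :
    (hubble A μ (x 0) - hubble A ν (x 0)) * A μ (x 0) ^ 2 * pd ν.succ (ψ μ) x
      = k * pd ν.succ (pd μ.succ f) x := by
  have hd : ∀ μ ν : Fin 3, DifferentiableAt ℝ (pd ν.succ (ψ μ)) x := fun μ ν =>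
    differentiableAt_of_smooth hU (contDiffOn_pd hU (h.smooth_space μ) _) hx
  have hs := fun μ => hA.hasDerivAt_sq μ (hUI hx)
  have h1 := pd_congr hU
    (f := fun y => A μ (y 0) ^ 2 * pd ν.succ (ψ μ) y + A ν (y 0) ^ 2 * pd μ.succ (ψ ν) y)
    (g := fun _ => 0) (fun y hy => h.space_space y hy μ ν hμν) hx 0
  rw [pd_const, pd_add
      ((differentiableAt_time (F := fun t => A μ t ^ 2) (hs μ).differentiableAt).fun_mul (hd μ ν))
      ((differentiableAt_time (F := fun t => A ν t ^ 2) (hs ν).differentiableAt).fun_mul (hd ν μ)),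
    pd_time_mul (F := fun t => A μ t ^ 2) (hs μ) (hd μ ν),
    pd_time_mul (F := fun t => A ν t ^ 2) (hs ν) (hd ν μ), if_pos rfl, if_pos rfl] at h1
  have h2 := h.pd_succ_time_space hA hU hUI hx μ ν
  have h3 := h.pd_succ_time_space hA hU hUI hx ν μ
  rw [pd_comm hU h.smooth_time hx] at h3
  have h4 := h.space_space x hx μ ν hμν
  linear_combination h1 / 2 - h2 / 2 - h3 / 2 - hubble A ν (x 0) * h4

/-- Compare two expressions for `k ∂_ν ∂_μ ∂_μ f`: the `x^μ` derivative of `hubble_sub_mul` and the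
`x^ν` derivative of `pd_pd_time`. By `diagonal`, both are functions of time multiplied by `∂_ν f`.
-/
theorem pd_time_mul_rate (h : CollineationEquations A γ k U f ψ) (hA : IsProperBianchiI A I)
    (hq : IsotropicRicci A I) (hU : IsOpen U) (hUI : U ⊆ domain I) {x : Event} (hx : x ∈ U)
    {μ ν : Fin 3} (hμν : μ ≠ ν) :
    (ricciRateFlow A γ μ (x 0) + ricciRate A γ μ (x 0)
      * (hubble A μ (x 0) - hubble A ν (x 0))) * pd ν.succ f x = 0 := by
  have hdf := differentiableAt_of_smooth hU h.smooth_time hx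
  have hI := hA.isOpen
  have hc : DifferentiableAt ℝ
      (fun t => (hubble A μ t - hubble A ν t) * A μ t ^ 2) (x 0) :=
    ((hA.hasDerivAt_hubble μ (hUI hx)).differentiableAt.sub
      (hA.hasDerivAt_hubble ν (hUI hx)).differentiableAt).mul
      (hA.hasDerivAt_sq μ (hUI hx)).differentiableAt
  have hE : DifferentiableAt ℝ (fun t => A μ t ^ 2 * ricciRateFlow A γ μ t) (x 0) := by
    refine (hA.hasDerivAt_sq μ (hUI hx)).differentiableAt.mul ?_
    have hexp : ContDiffOn ℝ ∞ (expansion A) I :=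
      ContDiffOn.sum fun ν _ => hA.contDiffOn_hubble ν
    have hr : ContDiffOn ℝ ∞ (ricciRate A γ μ) I :=
      (hA.contDiffOn_hubble μ).sub (contDiffOn_const.mul hexp)
    have hr' : ContDiffOn ℝ ∞ (deriv (ricciRate A γ μ)) I :=
      hr.deriv_of_isOpen hI (m := ∞) (by simp)
    exact differentiableAt_of_smooth hI (hr'.add ((contDiffOn_const.mul hexp).mul hr)) (hUI hx)
  have hff := contDiffOn_pd hU h.smooth_time μ.succ
  have h1 := pd_congr hU
    (f := fun y => ((hubble A μ (y 0) - hubble A ν (y 0)) * A μ (y 0) ^ 2) * pd ν.succ (ψ μ) y)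
    (g := fun y => k * pd ν.succ (pd μ.succ f) y)
    (fun y hy => h.hubble_sub_mul hA hU hUI hy hμν) hx μ.succ
  rw [pd_time_mul (F := fun t => (hubble A μ t - hubble A ν t) * A μ t ^ 2) hc.hasDerivAt
      (differentiableAt_of_smooth hU (contDiffOn_pd hU (h.smooth_space μ) _) hx),
    pd_const_mul (differentiableAt_of_smooth hU (contDiffOn_pd hU hff _) hx),
    if_neg (Fin.succ_ne_zero μ), pd_comm hU hff hx, pd_comm hU (h.smooth_space μ) hx] at h1
  have h2 := pd_congr hU (f := fun y => k * pd μ.succ (pd μ.succ f) y)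
    (g := fun y => (A μ (y 0) ^ 2 * ricciRateFlow A γ μ (y 0)) * f y)
    (fun y hy => h.pd_pd_time hA hq hU hUI hy μ) hx ν.succ
  rw [pd_time_mul (F := fun t => A μ t ^ 2 * ricciRateFlow A γ μ t) hE.hasDerivAt hdf,
    pd_const_mul (differentiableAt_of_smooth hU (contDiffOn_pd hU hff _) hx),
    if_neg (Fin.succ_ne_zero ν)] at h2
  have h3 := pd_congr hU (f := pd μ.succ (ψ μ))
    (g := fun y => -ricciRate A γ μ (y 0) * f y) (fun y hy => h.diagonal y hy μ) hx ν.succ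
  rw [pd_time_mul (F := fun t => -ricciRate A γ μ t)
      (hq.hasDerivAt_ricciRate hA (hUI hx) γ μ).neg hdf, if_neg (Fin.succ_ne_zero ν)] at h3
  rw [h3] at h1
  apply mul_left_cancel₀ (pow_ne_zero 2 (hA.ne_zero μ (x 0) (hUI hx)))
  linear_combination -h1 - h2

theorem exists_other_indices (ν : Fin 3) : ∃ μ l : Fin 3, μ ≠ ν ∧ l ≠ ν ∧ μ ≠ l ∧
    ∀ g : Fin 3 → ℝ, ∑ i, g i = g μ + g l + g ν := by
  fin_cases ν
  · exact ⟨1, 2, by decide, by decide, by decide, fun g => by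
      simp only [Fin.sum_univ_three, Fin.zero_eta]; ring⟩
  · exact ⟨0, 2, by decide, by decide, by decide, fun g => by
      simp only [Fin.sum_univ_three, Fin.mk_one]; ring⟩
  · exact ⟨0, 1, by decide, by decide, by decide, fun g => by
      simp only [Fin.sum_univ_three, Fin.reduceFinMk]⟩

/-- Subtracting `pd_time_mul_rate` for the two indices `μ`, `l` other than `ν` leaves `-2 (H_μ -
H_l) H_ν ∂_ν f = 0`, in which `γ` and `q` have cancelled. Where `H_ν = 0`, its derivative is `q ≠
0`. -/
theorem pd_time_eq_zero (h : CollineationEquations A γ k U f ψ) (hA : IsProperBianchiI A I)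
    (hq : IsotropicRicci A I) (hq0 : ∀ t ∈ I, ricciSpace A 0 t ≠ 0) (hU : IsOpen U)
    (hUI : U ⊆ domain I) (ν : Fin 3) : ∀ x ∈ U, pd ν.succ f x = 0 := by
  refine eq_zero_of_time_mul_eq_zero (F := hubble A ν)
    (F' := fun t => ricciSpace A 0 t - expansion A t * hubble A ν t) hU
    (contDiffOn_pd hU h.smooth_time _)
    (fun x hx => hq.hasDerivAt_hubble hA (hUI hx) ν) (fun x hx => ?_) (fun x hx h0 => ?_)
  · obtain ⟨μ, l, hμ, hl, hμl, hsum⟩ := exists_other_indices ν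
    have h1 := h.pd_time_mul_rate hA hq hU hUI hx hμ
    have h2 := h.pd_time_mul_rate hA hq hU hUI hx hl
    rw [hq.ricciRateFlow_eq hA (hUI hx), ricciRate] at h1 h2
    have hθ : expansion A (x 0) = _ := hsum fun i => hubble A i (x 0)
    apply mul_left_cancel₀ (sub_ne_zero.2 (hq.hubble_ne hA (hUI hx) hμl))
    linear_combination -(h1 - h2) / 2 - (hubble A μ (x 0) - hubble A l (x 0))
      * pd ν.succ f x / 2 * hθ
  · rw [h0]; simpa using hq0 _ (hUI hx)

/-- Without spatial gradients, `pd_pd_time` becomes `ricciRateFlow A γ μ * f = 0`. The difference of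
two of these is a multiple of `(γ - 2) θ (H_1 - H_2) f`, and `θ' = 3q ≠ 0` wherever `θ = 0`. -/
theorem time_eq_zero (h : CollineationEquations A γ k U f ψ) (hA : IsProperBianchiI A I)
    (hq : IsotropicRicci A I) (hq0 : ∀ t ∈ I, ricciSpace A 0 t ≠ 0) (hγ : γ ≠ 2) (hU : IsOpen U)
    (hUI : U ⊆ domain I) : ∀ x ∈ U, f x = 0 := by
  refine eq_zero_of_time_mul_eq_zero (F := expansion A)
    (F' := fun t => 3 * ricciSpace A 0 t - expansion A t ^ 2) hU h.smooth_time
    (fun x hx => hq.hasDerivAt_expansion hA (hUI hx)) (fun x hx => ?_) (fun x hx h0 => ?_)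
  · have hz : ∀ μ, ricciRateFlow A γ μ (x 0) * f x = 0 := by
      intro μ
      have h1 := h.pd_pd_time hA hq hU hUI hx μ
      rw [pd_congr hU (g := fun _ => 0) (h.pd_time_eq_zero hA hq hq0 hU hUI μ) hx, pd_const] at h1
      apply mul_left_cancel₀ (pow_ne_zero 2 (hA.ne_zero μ (x 0) (hUI hx)))
      linear_combination -h1
    have h1 := hz 0
    have h2 := hz 1
    rw [hq.ricciRateFlow_eq hA (hUI hx)] at h1 h2
    apply mul_left_cancel₀ (mul_ne_zero (sub_ne_zero.2 hγ) (sub_ne_zero.2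
      (hq.hubble_ne hA (hUI hx) (show (0 : Fin 3) ≠ 1 by decide))))
    linear_combination 2 * (h1 - h2)
  · rw [h0]; simpa using hq0 _ (hUI hx)

end CollineationEquations

/-! ### Linear equation of state and reduction to the Killing equations. -/

theorem IsotropicRicci.hasDerivAt_density (hq : IsotropicRicci A I) (hA : IsProperBianchiI A I)
    {t : ℝ} (ht : t ∈ I) :
    HasDerivAt (density A) (2 * expansion A t * (ricciSpace A 0 t - density A t)) t := by
  refine ((((hq.hasDerivAt_expansion hA ht).pow 2).sub (HasDerivAt.fun_sum (u := Finset.univ)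
    fun ν _ => (hq.hasDerivAt_hubble hA ht ν).pow 2)).div_const 2).congr_deriv ?_
  simp only [Fin.sum_univ_three, expansion, density]
  ring

theorem lieDeriv_metric (hA : IsProperBianchiI A I) {x : Event} (hx : x ∈ domain I) (X : VField)
    (a b : Fin 4) :
    lieDeriv X (metric A) a b x
      = X x 0 * pd 0 (fun y => metric A y a b) x
        + metric A x b b * pd a (fun y => X y b) x
        + metric A x a a * pd b (fun y => X y a) x := by
  simp only [lieDeriv, Finset.sum_add_distrib]
  congr 1
  · congr 1
    · rw [Finset.sum_eq_single 0]
      · intro c _ hc; simp [pd_metric hA hx, hc]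
      · simp
    · rw [Finset.sum_eq_single b]
      · intro c _ hc; simp [metric, hc]
      · simp
  · rw [Finset.sum_eq_single a]
    · intro c _ hc; simp [metric, hc.symm]
    · simp

/-- A Bianchi I solution whose Ricci tensor is that of a fluid with equation of state
`p = (γ - 1) ρ`. -/
structure IsLinearFluid (A : Fin 3 → ℝ → ℝ) (I : Set ℝ) (γ : ℝ) : Prop where
  space : ∀ t ∈ I, ∀ μ, ricciSpace A μ t = (2 - γ) / 2 * density A t
  time : ∀ t ∈ I, ricciTime A t = (3 * γ - 2) / 2 * density A t

theorem IsLinearFluid.isotropic {γ : ℝ} (h : IsLinearFluid A I γ) : IsotropicRicci A I :=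
  fun t ht μ => (h.space t ht μ).trans (h.space t ht 0).symm

/-- Energy conservation `ρ' = -θ (ρ + p)`, obtained from the evolution of the Hubble rates. -/
theorem IsLinearFluid.hasDerivAt_density {γ : ℝ} (h : IsLinearFluid A I γ)
    (hA : IsProperBianchiI A I) {t : ℝ} (ht : t ∈ I) :
    HasDerivAt (density A) (-γ * expansion A t * density A t) t := by
  refine (h.isotropic.hasDerivAt_density hA ht).congr_deriv ?_
  rw [h.space t ht 0]; ring

theorem IsLinearFluid.deriv_ricciTime {γ : ℝ} (h : IsLinearFluid A I γ)
    (hA : IsProperBianchiI A I) {t : ℝ} (ht : t ∈ I) :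
    deriv (ricciTime A) t = (3 * γ - 2) / 2 * (-γ * expansion A t * density A t) := by
  rw [Filter.EventuallyEq.deriv_eq
    (Filter.eventuallyEq_of_mem (hA.isOpen.mem_nhds ht) fun s hs => h.time s hs)]
  exact ((h.hasDerivAt_density hA ht).const_mul _).deriv

theorem IsLinearFluid.deriv_ricciSpace {γ : ℝ} (h : IsLinearFluid A I γ)
    (hA : IsProperBianchiI A I) {t : ℝ} (ht : t ∈ I) (μ : Fin 3) :
    deriv (ricciSpace A μ) t = (2 - γ) / 2 * (-γ * expansion A t * density A t) := by
  rw [Filter.EventuallyEq.deriv_eq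
    (Filter.eventuallyEq_of_mem (hA.isOpen.mem_nhds ht) fun s hs => h.space s hs μ)]
  exact ((h.hasDerivAt_density hA ht).const_mul _).deriv

/-- Every Ricci component is a constant or a constant times `A_μ²`, multiplied by `ρ`; dividing `ρ`
out leaves equations with coefficients in the Hubble rates. -/
theorem IsLinearFluid.collineationEquations {γ : ℝ} (h : IsLinearFluid A I γ)
    (hA : IsProperBianchiI A I) (hγ : γ ≠ 2) (hγ' : 3 * γ - 2 ≠ 0)
    {U : Set Event} {X : VField} (hUI : U ⊆ domain I) (hρ : ∀ t ∈ I, density A t ≠ 0)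
    (hX : IsRicciCollineation (metric A) U X) :
    CollineationEquations A γ ((3 * γ - 2) / (2 - γ)) U (fun y => X y 0)
      (fun μ y => X y μ.succ) := by
  have hs := contDiffOn_pi.1 hX.smooth
  have hγ0 : (2 - γ) ≠ 0 := sub_ne_zero.2 hγ.symm
  refine ⟨hs 0, fun μ => hs μ.succ, fun x hx => ?_, fun x hx μ => ?_, fun x hx μ => ?_,
    fun x hx μ ν hμν => ?_⟩
  · have h1 := hX.lie_eq_zero x hx 0 0
    simp only [lieDeriv_ricci hA (hUI hx), pd_ricci hA (hUI hx), ricci_metric_zero hA (hUI hx),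
      h.deriv_ricciTime hA (hUI hx), h.time _ (hUI hx), and_self, if_true, Fin.cases_zero] at h1
    apply mul_left_cancel₀ (mul_ne_zero hγ' (hρ _ (hUI hx)))
    linear_combination h1
  · have h1 := hX.lie_eq_zero x hx 0 μ.succ
    simp only [lieDeriv_ricci hA (hUI hx), pd_ricci hA (hUI hx), ricci_metric_zero hA (hUI hx),
      ricci_metric_succ hA (hUI hx), h.time _ (hUI hx), h.space _ (hUI hx),
      (Fin.succ_ne_zero μ).symm, and_false, if_false] at h1
    apply mul_left_cancel₀ (mul_ne_zero hγ0 (hρ _ (hUI hx)))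
    field_simp
    linear_combination 2 * h1
  · have h1 := hX.lie_eq_zero x hx μ.succ μ.succ
    simp only [lieDeriv_ricci hA (hUI hx), pd_ricci hA (hUI hx), ricci_metric_succ hA (hUI hx),
      h.deriv_ricciSpace hA (hUI hx), h.space _ (hUI hx), and_self, if_true, Fin.cases_succ] at h1
    rw [ricciRate]
    apply mul_left_cancel₀ (mul_ne_zero (pow_ne_zero 2 (hA.ne_zero μ _ (hUI hx)))
      (mul_ne_zero hγ0 (hρ _ (hUI hx))))
    linear_combination h1
  · have h1 := hX.lie_eq_zero x hx μ.succ ν.succ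
    simp only [lieDeriv_ricci hA (hUI hx), pd_ricci hA (hUI hx), ricci_metric_succ hA (hUI hx),
      h.space _ (hUI hx), Fin.succ_inj, hμν, and_false, if_false] at h1
    apply mul_left_cancel₀ (mul_ne_zero hγ0 (hρ _ (hUI hx)))
    linear_combination 2 * h1

/-- Once `X⁰ = 0`, the equations say that `X` is independent of time and preserves each spatial
metric, which is the Killing system. -/
theorem CollineationEquations.isKilling {γ k : ℝ} {U : Set Event} {X : VField}
    (h : CollineationEquations A γ k U (fun y => X y 0) fun μ y => X y μ.succ)
    (hA : IsProperBianchiI A I) (hq : IsotropicRicci A I) (hq0 : ∀ t ∈ I, ricciSpace A 0 t ≠ 0)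
    (hγ : γ ≠ 2) (hU : IsOpen U) (hUI : U ⊆ domain I) (hX : ContDiffOn ℝ ∞ X U) :
    IsKilling (metric A) U X := by
  have hf : ∀ x ∈ U, X x 0 = 0 := h.time_eq_zero hA hq hq0 hγ hU hUI
  refine ⟨hX, fun x hx a b => ?_⟩
  have hpd : ∀ a, pd a (fun y => X y 0) x = 0 := fun a => by
    rw [pd_congr hU (g := fun _ => 0) hf hx, pd_const]
  have ht : ∀ μ : Fin 3, pd 0 (fun y => X y μ.succ) x = 0 := fun μ => by
    have h1 := h.time_space x hx μ
    rw [hpd, mul_zero] at h1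
    exact (mul_eq_zero.1 h1).resolve_left (pow_ne_zero 2 (hA.ne_zero μ _ (hUI hx)))
  have hd : ∀ μ : Fin 3, pd μ.succ (fun y => X y μ.succ) x = 0 := fun μ => by
    have h1 := h.diagonal x hx μ
    simpa [hf x hx] using h1
  rw [lieDeriv_metric hA (hUI hx), hf x hx]
  refine Fin.cases ?_ (fun μ => ?_) a <;> refine Fin.cases ?_ (fun ν => ?_) b
  · simp [hpd]
  · simp [hpd, ht]
  · simp [hpd, ht]
  · by_cases hμν : μ = ν
    · subst hμν; simp [hd]
    · simp only [metric, Matrix.diagonal_apply_eq, Fin.cons_succ]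
      linear_combination h.space_space x hx μ ν hμν

theorem IsLinearFluid.isKilling_of_isRicciCollineation {γ : ℝ} (h : IsLinearFluid A I γ)
    (hA : IsProperBianchiI A I) (hdet : ∀ x ∈ domain I, (ricci (metric A) x).det ≠ 0)
    {U : Set Event} {X : VField} (hU : IsOpen U) (hUI : U ⊆ domain I)
    (hX : IsRicciCollineation (metric A) U X) : IsKilling (metric A) U X := by
  -- A point of `U` is needed to rule out `γ = 2` (where `q = 0`) and `γ = 2/3` (where `R₀₀ = 0`) by
  -- non-degeneracy.
  rcases U.eq_empty_or_nonempty with rfl | ⟨x₀, hx₀⟩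
  · exact ⟨hX.smooth, fun x hx => hx.elim⟩
  have hne : ∀ t ∈ I, ricciTime A t ≠ 0 ∧ ricciSpace A 0 t ≠ 0 := by
    intro t ht
    have h1 := hdet (fun _ => t) ht
    rw [ricci_metric hA ht, Matrix.det_diagonal, Fin.prod_univ_succ] at h1
    simp only [Fin.cons_zero, Fin.cons_succ, Fin.prod_univ_three] at h1
    exact ⟨fun h => h1 (by simp [h]), fun h => h1 (by simp [h])⟩
  have ht₀ : x₀ 0 ∈ I := hUI hx₀
  have hγ : γ ≠ 2 := fun hγ => (hne _ ht₀).2 (by rw [h.space _ ht₀, hγ]; ring)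
  have hγ' : 3 * γ - 2 ≠ 0 := fun hγ => (hne _ ht₀).1 (by rw [h.time _ ht₀, hγ]; ring)
  have hρ : ∀ t ∈ I, density A t ≠ 0 := fun t ht h0 => (hne t ht).1 (by rw [h.time t ht, h0]; ring)
  exact (h.collineationEquations hA hγ hγ' hUI hρ hX).isKilling hA h.isotropic
    (fun t ht => (hne t ht).2) hγ hU hUI hX.smooth

theorem IsPerfectFluid.isLinearFluid (hA : IsProperBianchiI A I) {ρ p : Event → ℝ} {u : VField}
    (h : IsPerfectFluid (metric A) (domain I) ρ p u) {γ : ℝ}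
    (hp : ∀ x ∈ domain I, p x = (γ - 1) * ρ x) : IsLinearFluid A I γ := by
  refine ⟨fun t ht μ => ?_, fun t ht => ?_⟩ <;>
    obtain ⟨h1, h2, h3⟩ := h.field_equations hA (x := fun _ => t) ht <;>
    have h4 := hp (fun _ => t) ht
  · rw [h1 μ, h4, h3]; ring
  · rw [h2, h4, h3]; ring

end BianchiI

theorem proposition5 (A : Fin 3 → ℝ → ℝ) (I : Set ℝ) (hA : BianchiI.IsProperBianchiI A I)
    (ρ p : BianchiI.Event → ℝ) (u : BianchiI.VField)
    (hfluid : BianchiI.IsPerfectFluid (BianchiI.metric A) (BianchiI.domain I) ρ p u) :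
    -- perfect fluids whose metric functions satisfy the ratio condition
    ((∀ x ∈ BianchiI.domain I, BianchiI.ricci (BianchiI.metric A) x 0 0 ≠ 0) →
      ∀ (c C : Fin 3 → ℝ) (τ : ℝ → ℝ), (∀ μ, C μ ≠ 0) → BianchiI.IsRicciTime A I τ →
        BianchiI.RatioCondition A I c C τ →
          -- the condition involves the differences of the `c μ` only: take the constants
          -- with these differences whose sum is zero
          BianchiI.IsRicciCollineation (BianchiI.metric A) (BianchiI.domain I)
            (BianchiI.ricciField A fun μ => c μ - (c 0 + c 1 + c 2) / 3) ∧
          -- if the `c μ` are the exponents of the spatial Ricci components, take them as they are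
          ((∀ x ∈ BianchiI.domain I, ∀ μ : Fin 3,
              BianchiI.ricci (BianchiI.metric A) x μ.succ μ.succ
                = C μ * Real.exp (2 * c μ * τ (x 0))) →
            BianchiI.IsRicciCollineation (BianchiI.metric A) (BianchiI.domain I)
              (BianchiI.ricciField A c))) ∧
    -- linear barotropic equation of state: every Ricci collineation is a Killing vector field
    (∀ γ : ℝ, (∀ x ∈ BianchiI.domain I, p x = (γ - 1) * ρ x) →
      (∀ x ∈ BianchiI.domain I, (BianchiI.ricci (BianchiI.metric A) x).det ≠ 0) →
        ∀ (U : Set BianchiI.Event) (X : BianchiI.VField), IsOpen U → U ⊆ BianchiI.domain I →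
          BianchiI.IsRicciCollineation (BianchiI.metric A) U X →
            BianchiI.IsKilling (BianchiI.metric A) U X) := by
  refine ⟨fun h0 c C τ _ hτ hc => ⟨?_, ?_⟩, fun γ hp hdet U X hU hUI hX => ?_⟩
  · exact BianchiI.isRicciCollineation_of_ratioCondition hA
      (fun t ht => hfluid.ricciSpace_eq hA ht) h0 hτ hc
  · exact BianchiI.isRicciCollineation_of_exponents hA h0 hτ
  · exact (hfluid.isLinearFluid hA hp).isKilling_of_isRicciCollineation hA hdet hU hUI hX
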